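/- Let $t$ be a real number with $t\neq 0,\pm1$. Let $U_t(su(2))$ be the complex Hopf algebra generated by $e,f,k^{\pm1}$ with relations $kk^{-1}=k^{-1}k=1$, $ke=t^2ek$, $kf=t^{-2}fk$, $[e,f]=(k^2-k^{-2})/(t^2-t^{-2})$, coproduct $\Delta(k^{\pm1})=k^{\pm1}\otimes k^{\pm1}$, $\Delta(e)=e\otimes k^{-1}+k\otimes e$, $\Delta(f)=f\otimes k^{-1}+k\otimes f$, counit $\varepsilon(k^{\pm1})=1$, $\varepsilon(e)=\varepsilon(f)=0$, and antipode $S(k^{\pm1})=k^{\mp1}$, $S(e)=-t^{-2}e$, $S(f)=-t^2f$. Let $ad$ be its adjoint representation on itself, $ad_a(b)=\sum_i a^{(1)}_i\,b\,S(a^{(2)}_i)$ where $\Delta(a)=\sum_i a^{(1)}_i\otimes a^{(2)}_i$. Put $[n]=\frac{t^{2n}-t^{-2n}}{t^2-t^{-2}}$ and $[n]!=[1][2]\cdots[n]$. For a natural number $l$ and $m=l,l-1,\dots,-l$ define $$\lambda^l_m=\left(\frac{[l+m]!}{[2l]!\,[l-m]!}\right)^{1/2}(ad_f)^{l-m}\left(e^l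 k^{-l}\right).$$ Then for all $m=l,l-1,\dots,-l$ $$ad_e\,\lambda^l_m=([l-m][l+m+1])^{1/2}\lambda^l_{m+1},\qquad ad_f\,\lambda^l_m=([l+m][l-m+1])^{1/2}\lambda^l_{m-1},\qquad ad_{k^{\pm1}}\lambda^l_m=t^{\pm2m}\lambda^l_m,$$ where the right-hand sides of the first formula for $m=l$ and of the second for $m=-l$ are $0$. Moreover the $2l+1$ vectors $\lambda^l_m$ are linearly independent, and their linear span $U^l\subset U_t(su(2))$ is an irreducible $(2l+1)$-dimensional subrepresentation of the adjoint representation. -/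

import Mathlib

open scoped TensorProduct

noncomputable section

/-! ### The adjoint representation of a Hopf algebra -/

namespace HopfAlgebra

variable (R A : Type*) [CommSemiring R] [Semiring A] [HopfAlgebra R A]

/-- The antipode of a Hopf algebra, as an algebra homomorphism into the opposite algebra. -/
def antipodeOp : A →ₐ[R] Aᵐᵒᵖ :=
  AlgHom.ofLinearMap ((MulOpposite.opLinearEquiv R).toLinearMap ∘ₗ antipode R)
    (by simp)
    (fun x y => MulOpposite.unop_injective (by simp [antipode_mul_antidistrib]))

/-- The algebra homomorphism `A ⊗ A → End A` sending `x ⊗ y` to `b ↦ x * b * S y`. -/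
def conjEnd : A ⊗[R] A →ₐ[R] Module.End R A :=
  Algebra.TensorProduct.lift (Algebra.lmul R A)
    ((Algebra.lsmul R R A : Aᵐᵒᵖ →ₐ[R] Module.End R A).comp (antipodeOp R A))
    (fun x y => LinearMap.ext fun b => by simp [antipodeOp, mul_assoc])

/-- The adjoint representation of a Hopf algebra on itself: `ad a b = ∑ a₍₁₎ * b * S a₍₂₎`. -/
def ad : A →ₐ[R] Module.End R A :=
  (conjEnd R A).comp (Bialgebra.comulAlgHom R A)

variable {R A}

theorem conjEnd_tmul (x y b : A) :
    conjEnd R A (x ⊗ₜ[R] y) b = x * b * antipode R y := by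
  simp [conjEnd, antipodeOp, mul_assoc]

theorem ad_apply {ι : Type*} (a b : A) (r : Coalgebra.Repr R a ι) :
    ad R A a b = ∑ i ∈ r.index, r.left i * b * antipode R (r.right i) := by
  have h : ad R A a b = conjEnd R A (Coalgebra.comul a) b := rfl
  rw [h, ← r.eq, map_sum, LinearMap.sum_apply]
  simp only [conjEnd_tmul]

/-- The adjoint action as a representation of (the multiplicative monoid of) `A`. -/
def adRep (R A : Type*) [CommSemiring R] [Semiring A] [HopfAlgebra R A] :
    Representation R A A :=
  (ad R A : A →* Module.End R A)

end HopfAlgebra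

/-! ### The quantum algebra `U_t(sl(2))` -/

namespace QuantumSU2

/-- The generators `e`, `f`, `k`, `k⁻¹`. -/
inductive Gen : Type
  | e
  | f
  | k
  | kinv

open FreeAlgebra in
/-- The defining relations. -/
inductive Rel (t : ℂ) : FreeAlgebra ℂ Gen → FreeAlgebra ℂ Gen → Prop
  | k_kinv : Rel t (ι ℂ Gen.k * ι ℂ Gen.kinv) 1
  | kinv_k : Rel t (ι ℂ Gen.kinv * ι ℂ Gen.k) 1
  | k_e : Rel t (ι ℂ Gen.k * ι ℂ Gen.e) (t ^ 2 • (ι ℂ Gen.e * ι ℂ Gen.k))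
  | k_f : Rel t (ι ℂ Gen.k * ι ℂ Gen.f) ((t ^ 2)⁻¹ • (ι ℂ Gen.f * ι ℂ Gen.k))
  | e_f : Rel t (ι ℂ Gen.e * ι ℂ Gen.f - ι ℂ Gen.f * ι ℂ Gen.e)
      ((t ^ 2 - (t ^ 2)⁻¹)⁻¹ • (ι ℂ Gen.k ^ 2 - ι ℂ Gen.kinv ^ 2))

/-- The quantum algebra with parameter `t`: the associative unital complex algebra generated by
`e`, `f`, `k`, `k⁻¹` with the relations above. -/
def U (t : ℂ) : Type := RingQuot (Rel t)

instance (t : ℂ) : Ring (U t) := inferInstanceAs (Ring (RingQuot (Rel t)))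
instance (t : ℂ) : Algebra ℂ (U t) := inferInstanceAs (Algebra ℂ (RingQuot (Rel t)))

/-- The quotient map from the free algebra. -/
def mk (t : ℂ) : FreeAlgebra ℂ Gen →ₐ[ℂ] U t := RingQuot.mkAlgHom ℂ (Rel t)

/-- The class of a generator. -/
def gen (t : ℂ) (g : Gen) : U t := mk t (FreeAlgebra.ι ℂ g)

/-- The generator `e`. -/
abbrev e (t : ℂ) : U t := gen t Gen.e
/-- The generator `f`. -/
abbrev f (t : ℂ) : U t := gen t Gen.f
/-- The generator `k`. -/
abbrev k (t : ℂ) : U t := gen t Gen.k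
/-- The generator `k⁻¹`. -/
abbrev kinv (t : ℂ) : U t := gen t Gen.kinv

section relations

variable (t : ℂ)

theorem mk_rel {x y : FreeAlgebra ℂ Gen} (h : Rel t x y) : mk t x = mk t y :=
  RingQuot.mkAlgHom_rel ℂ h

theorem k_mul_kinv : k t * kinv t = 1 := by
  simpa [gen] using mk_rel t (Rel.k_kinv (t := t))

theorem kinv_mul_k : kinv t * k t = 1 := by
  simpa [gen] using mk_rel t (Rel.kinv_k (t := t))

theorem k_mul_e : k t * e t = t ^ 2 • (e t * k t) := by
  simpa only [gen, map_mul, map_smul] using mk_rel t (Rel.k_e (t := t))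

theorem k_mul_f : k t * f t = (t ^ 2)⁻¹ • (f t * k t) := by
  simpa only [gen, map_mul, map_smul] using mk_rel t (Rel.k_f (t := t))

theorem e_mul_f_sub :
    e t * f t - f t * e t = (t ^ 2 - (t ^ 2)⁻¹)⁻¹ • (k t ^ 2 - kinv t ^ 2) := by
  simpa only [gen, map_mul, map_smul, map_sub, map_pow] using
    mk_rel t (Rel.e_f (t := t))

theorem e_mul_kinv : e t * kinv t = t ^ 2 • (kinv t * e t) := by
  have h := congrArg (fun x => kinv t * x * kinv t) (k_mul_e t)
  simp only [mul_smul_comm, smul_mul_assoc] at h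
  rwa [← mul_assoc, kinv_mul_k, one_mul, mul_assoc, mul_assoc, k_mul_kinv, mul_one] at h

theorem f_mul_kinv : f t * kinv t = (t ^ 2)⁻¹ • (kinv t * f t) := by
  have h := congrArg (fun x => kinv t * x * kinv t) (k_mul_f t)
  simp only [mul_smul_comm, smul_mul_assoc] at h
  rwa [← mul_assoc, kinv_mul_k, one_mul, mul_assoc, mul_assoc, k_mul_kinv, mul_one] at h

/-- For the degenerate value `t = 0` (where `0⁻¹ = 0`) the relations force `e = f = 0`. -/
theorem e_zero : e 0 = 0 := by
  have h : k 0 * e 0 = 0 := by simpa using k_mul_e 0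
  calc e 0 = kinv 0 * (k 0 * e 0) := by rw [← mul_assoc, kinv_mul_k, one_mul]
    _ = 0 := by rw [h, mul_zero]

theorem f_zero : f 0 = 0 := by
  have h : k 0 * f 0 = 0 := by simpa using k_mul_f 0
  calc f 0 = kinv 0 * (k 0 * f 0) := by rw [← mul_assoc, kinv_mul_k, one_mul]
    _ = 0 := by rw [h, mul_zero]

end relations

/-- The universal property of `U t`: algebra homomorphisms are determined by images of the
generators that satisfy the relations. -/
def lift {t : ℂ} {B : Type*} [Ring B] [Algebra ℂ B] (g : Gen → B)
    (h1 : g Gen.k * g Gen.kinv = 1) (h2 : g Gen.kinv * g Gen.k = 1)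
    (h3 : g Gen.k * g Gen.e = t ^ 2 • (g Gen.e * g Gen.k))
    (h4 : g Gen.k * g Gen.f = (t ^ 2)⁻¹ • (g Gen.f * g Gen.k))
    (h5 : g Gen.e * g Gen.f - g Gen.f * g Gen.e =
      (t ^ 2 - (t ^ 2)⁻¹)⁻¹ • (g Gen.k ^ 2 - g Gen.kinv ^ 2)) : U t →ₐ[ℂ] B :=
  RingQuot.liftAlgHom ℂ ⟨FreeAlgebra.lift ℂ g, by
    intro x y h
    cases h <;>
      simp only [map_mul, map_one, map_smul, map_sub, map_pow, FreeAlgebra.lift_ι_apply] <;>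
      assumption⟩

@[simp]
theorem lift_gen {t : ℂ} {B : Type*} [Ring B] [Algebra ℂ B] (g : Gen → B) (h1 h2 h3 h4 h5)
    (x : Gen) : lift (t := t) g h1 h2 h3 h4 h5 (gen t x) = g x := by
  simp only [lift, gen, mk]
  erw [RingQuot.liftAlgHom_mkAlgHom_apply]
  exact FreeAlgebra.lift_ι_apply g x

theorem induction {t : ℂ} {p : U t → Prop} (hs : ∀ c : ℂ, p (algebraMap ℂ (U t) c))
    (hg : ∀ x, p (gen t x)) (hadd : ∀ a b, p a → p b → p (a + b))
    (hmul : ∀ a b, p a → p b → p (a * b)) (a : U t) : p a := by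
  obtain ⟨x, rfl⟩ : ∃ x, mk t x = a := RingQuot.mkAlgHom_surjective ℂ (Rel t) a
  induction x using FreeAlgebra.induction with
  | grade0 r => rw [AlgHom.commutes]; exact hs r
  | grade1 x => exact hg x
  | mul a b ha hb => rw [map_mul]; exact hmul _ _ ha hb
  | add a b ha hb => rw [map_add]; exact hadd _ _ ha hb

theorem algHom_ext {t : ℂ} {B : Type*} [Ring B] [Algebra ℂ B] {φ ψ : U t →ₐ[ℂ] B}
    (h : ∀ x, φ (gen t x) = ψ (gen t x)) : φ = ψ := by
  ext a
  induction a using induction with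
  | hs c => simp
  | hg x => exact h x
  | hadd a b ha hb => simp [ha, hb]
  | hmul a b ha hb => simp [ha, hb]

/-! ### The Hopf algebra structure -/

/-- The coproduct on generators. -/
def comulGen (t : ℂ) : Gen → U t ⊗[ℂ] U t
  | Gen.e => e t ⊗ₜ kinv t + k t ⊗ₜ e t
  | Gen.f => f t ⊗ₜ kinv t + k t ⊗ₜ f t
  | Gen.k => k t ⊗ₜ k t
  | Gen.kinv => kinv t ⊗ₜ kinv t

/-- The counit on generators. -/
def counitGen : Gen → ℂ
  | Gen.e => 0
  | Gen.f => 0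
  | Gen.k => 1
  | Gen.kinv => 1

/-- The antipode on generators. -/
def antipodeGen (t : ℂ) : Gen → U t
  | Gen.e => -(t ^ 2)⁻¹ • e t
  | Gen.f => -t ^ 2 • f t
  | Gen.k => kinv t
  | Gen.kinv => k t

/-- The coproduct `Δ`. -/
def comulHom (t : ℂ) : U t →ₐ[ℂ] U t ⊗[ℂ] U t :=
  lift (comulGen t)
    (by simp [comulGen, k_mul_kinv, Algebra.TensorProduct.one_def])
    (by simp [comulGen, kinv_mul_k, Algebra.TensorProduct.one_def])
    (by
      simp only [comulGen, mul_add, add_mul, Algebra.TensorProduct.tmul_mul_tmul, k_mul_e,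
        k_mul_kinv, kinv_mul_k, TensorProduct.smul_tmul', TensorProduct.tmul_smul, smul_add])
    (by
      simp only [comulGen, mul_add, add_mul, Algebra.TensorProduct.tmul_mul_tmul, k_mul_f,
        k_mul_kinv, kinv_mul_k, TensorProduct.smul_tmul', TensorProduct.tmul_smul, smul_add])
    (by
      by_cases ht : t = 0
      · subst ht
        simp [comulGen, e_zero, f_zero]
      · have h1 : (e t * f t) ⊗ₜ[ℂ] (kinv t * kinv t) - (f t * e t) ⊗ₜ[ℂ] (kinv t * kinv t) =
            (t ^ 2 - (t ^ 2)⁻¹)⁻¹ •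
              ((k t ^ 2) ⊗ₜ[ℂ] (kinv t ^ 2) - (kinv t ^ 2) ⊗ₜ[ℂ] (kinv t ^ 2)) := by
          rw [← TensorProduct.sub_tmul, e_mul_f_sub, ← TensorProduct.smul_tmul',
            TensorProduct.sub_tmul, pow_two (kinv t)]
        have h2 : (k t * k t) ⊗ₜ[ℂ] (e t * f t) - (k t * k t) ⊗ₜ[ℂ] (f t * e t) =
            (t ^ 2 - (t ^ 2)⁻¹)⁻¹ •
              ((k t ^ 2) ⊗ₜ[ℂ] (k t ^ 2) - (k t ^ 2) ⊗ₜ[ℂ] (kinv t ^ 2)) := by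
          rw [← TensorProduct.tmul_sub, e_mul_f_sub, TensorProduct.tmul_smul,
            TensorProduct.tmul_sub, pow_two (k t)]
        have h3 : (k t * f t) ⊗ₜ[ℂ] (e t * kinv t) = (f t * k t) ⊗ₜ[ℂ] (kinv t * e t) := by
          rw [k_mul_f, e_mul_kinv, TensorProduct.tmul_smul, ← TensorProduct.smul_tmul', smul_smul,
            mul_inv_cancel₀ (pow_ne_zero 2 ht), one_smul]
        have h4 : (k t * e t) ⊗ₜ[ℂ] (f t * kinv t) = (e t * k t) ⊗ₜ[ℂ] (kinv t * f t) := by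
          rw [k_mul_e, f_mul_kinv, TensorProduct.tmul_smul, ← TensorProduct.smul_tmul', smul_smul,
            inv_mul_cancel₀ (pow_ne_zero 2 ht), one_smul]
        have h5 : (comulGen t Gen.k ^ 2 - comulGen t Gen.kinv ^ 2) =
            ((k t ^ 2) ⊗ₜ[ℂ] (k t ^ 2) - (k t ^ 2) ⊗ₜ[ℂ] (kinv t ^ 2)) +
            ((k t ^ 2) ⊗ₜ[ℂ] (kinv t ^ 2) - (kinv t ^ 2) ⊗ₜ[ℂ] (kinv t ^ 2)) := by
          simp only [comulGen, Algebra.TensorProduct.tmul_pow]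
          abel
        rw [h5, smul_add, ← h1, ← h2]
        simp only [comulGen, mul_add, add_mul, Algebra.TensorProduct.tmul_mul_tmul]
        rw [h3, h4]
        abel)

/-- The counit `ε`. -/
def counitHom (t : ℂ) : U t →ₐ[ℂ] ℂ :=
  lift counitGen (by simp [counitGen]) (by simp [counitGen]) (by simp [counitGen])
    (by simp [counitGen]) (by simp [counitGen])

/-- The antipode `S`, as an algebra homomorphism into the opposite algebra. -/
def antipodeHom (t : ℂ) : U t →ₐ[ℂ] (U t)ᵐᵒᵖ :=
  lift (fun x => MulOpposite.op (antipodeGen t x))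
    (by simp [antipodeGen, ← MulOpposite.op_mul, k_mul_kinv])
    (by simp [antipodeGen, ← MulOpposite.op_mul, kinv_mul_k])
    (by
      simp only [antipodeGen, ← MulOpposite.op_mul, ← MulOpposite.op_smul, smul_mul_assoc,
        mul_smul_comm, e_mul_kinv]
      simp only [smul_smul, mul_comm])
    (by
      simp only [antipodeGen, ← MulOpposite.op_mul, ← MulOpposite.op_smul, smul_mul_assoc,
        mul_smul_comm, f_mul_kinv]
      simp only [smul_smul, mul_comm])
    (by
      by_cases ht : t = 0
      · subst ht
        simp [antipodeGen, e_zero, f_zero]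
      · have h2 : t ^ 2 ≠ 0 := pow_ne_zero 2 ht
        have h := e_mul_f_sub t
        simp only [antipodeGen, ← MulOpposite.op_mul, ← MulOpposite.op_smul, ← MulOpposite.op_sub,
          ← MulOpposite.op_pow, smul_mul_assoc, mul_smul_comm, smul_smul, neg_mul_neg,
          mul_inv_cancel₀ h2, inv_mul_cancel₀ h2, one_smul]
        rw [← neg_sub (e t * f t), h, ← smul_neg, neg_sub])

instance instBialgebra (t : ℂ) : Bialgebra ℂ (U t) :=
  Bialgebra.ofAlgHom (comulHom t) (counitHom t)
    (algHom_ext fun x => by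
      cases x <;>
        simp [comulHom, comulGen, TensorProduct.add_tmul, TensorProduct.tmul_add, add_assoc])
    (algHom_ext fun x => by
      cases x <;> simp [comulHom, comulGen, counitHom, counitGen])
    (algHom_ext fun x => by
      cases x <;> simp [comulHom, comulGen, counitHom, counitGen])

/-- The antipode `S`, as a linear map. -/
def antipodeLin (t : ℂ) : U t →ₗ[ℂ] U t :=
  (MulOpposite.opLinearEquiv ℂ).symm.toLinearMap ∘ₗ (antipodeHom t).toLinearMap

theorem antipodeLin_gen (t : ℂ) (x : Gen) : antipodeLin t (gen t x) = antipodeGen t x := by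
  simp [antipodeLin, antipodeHom]

theorem antipodeLin_mul (t : ℂ) (a b : U t) :
    antipodeLin t (a * b) = antipodeLin t b * antipodeLin t a := by
  simp [antipodeLin]

theorem antipodeLin_algebraMap (t : ℂ) (c : ℂ) :
    antipodeLin t (algebraMap ℂ (U t) c) = algebraMap ℂ (U t) c := by
  simp [antipodeLin]

theorem left_mul (t : ℂ) (w z : U t ⊗[ℂ] U t) (r : ℂ)
    (hw : LinearMap.mul' ℂ (U t) ((antipodeLin t).rTensor (U t) w) = algebraMap ℂ (U t) r) :
    LinearMap.mul' ℂ (U t) ((antipodeLin t).rTensor (U t) (w * z)) =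
      r • LinearMap.mul' ℂ (U t) ((antipodeLin t).rTensor (U t) z) := by
  induction z with
  | zero => simp
  | add x y hx hy => rw [mul_add, map_add, map_add, hx, hy, map_add, map_add, smul_add]
  | tmul b d =>
    have key : LinearMap.mul' ℂ (U t) ((antipodeLin t).rTensor (U t) (w * (b ⊗ₜ d))) =
        antipodeLin t b * LinearMap.mul' ℂ (U t) ((antipodeLin t).rTensor (U t) w) * d := by
      clear hw
      induction w with
      | zero => simp
      | add x y hx hy => rw [add_mul, map_add, map_add, hx, hy, map_add, map_add, mul_add, add_mul]
      | tmul a c => simp [antipodeLin_mul, mul_assoc]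
    rw [key, hw, ← Algebra.commutes, mul_assoc, ← Algebra.smul_def]
    simp

theorem right_mul (t : ℂ) (w z : U t ⊗[ℂ] U t) (r : ℂ)
    (hz : LinearMap.mul' ℂ (U t) ((antipodeLin t).lTensor (U t) z) = algebraMap ℂ (U t) r) :
    LinearMap.mul' ℂ (U t) ((antipodeLin t).lTensor (U t) (w * z)) =
      r • LinearMap.mul' ℂ (U t) ((antipodeLin t).lTensor (U t) w) := by
  induction w with
  | zero => simp
  | add x y hx hy => rw [add_mul, map_add, map_add, hx, hy, map_add, map_add, smul_add]
  | tmul a c =>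
    have key : LinearMap.mul' ℂ (U t) ((antipodeLin t).lTensor (U t) ((a ⊗ₜ c) * z)) =
        a * LinearMap.mul' ℂ (U t) ((antipodeLin t).lTensor (U t) z) * antipodeLin t c := by
      clear hz
      induction z with
      | zero => simp
      | add x y hx hy => rw [mul_add, map_add, map_add, hx, hy, map_add, map_add, mul_add, add_mul]
      | tmul b d => simp [antipodeLin_mul, mul_assoc]
    rw [key, hz, ← Algebra.commutes, mul_assoc, ← Algebra.smul_def]
    simp

theorem kinv_mul_e (t : ℂ) : kinv t * e t = (t ^ 2)⁻¹ • (e t * kinv t) := by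
  by_cases ht : t = 0
  · subst ht
    simp [e_zero]
  · rw [e_mul_kinv, smul_smul, inv_mul_cancel₀ (pow_ne_zero 2 ht), one_smul]

theorem kinv_mul_f (t : ℂ) : kinv t * f t = t ^ 2 • (f t * kinv t) := by
  by_cases ht : t = 0
  · subst ht
    simp [f_zero]
  · rw [f_mul_kinv, smul_smul, mul_inv_cancel₀ (pow_ne_zero 2 ht), one_smul]

theorem left_gen (t : ℂ) (x : Gen) :
    LinearMap.mul' ℂ (U t) ((antipodeLin t).rTensor (U t) (comulGen t x)) =
      algebraMap ℂ (U t) (counitGen x) := by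
  cases x <;>
    simp [comulGen, counitGen, antipodeLin_gen, antipodeGen, kinv_mul_e, kinv_mul_f, k_mul_kinv,
      kinv_mul_k]

theorem e_eq (t : ℂ) : (t ^ 2)⁻¹ • (k t * e t) = e t * k t := by
  by_cases ht : t = 0
  · subst ht
    simp [e_zero]
  · rw [k_mul_e, smul_smul, inv_mul_cancel₀ (pow_ne_zero 2 ht), one_smul]

theorem f_eq (t : ℂ) : t ^ 2 • (k t * f t) = f t * k t := by
  by_cases ht : t = 0
  · subst ht
    simp [f_zero]
  · rw [k_mul_f, smul_smul, mul_inv_cancel₀ (pow_ne_zero 2 ht), one_smul]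

theorem right_gen (t : ℂ) (x : Gen) :
    LinearMap.mul' ℂ (U t) ((antipodeLin t).lTensor (U t) (comulGen t x)) =
      algebraMap ℂ (U t) (counitGen x) := by
  cases x <;>
    simp [comulGen, counitGen, antipodeLin_gen, antipodeGen, e_eq, f_eq, k_mul_kinv, kinv_mul_k]

instance instHopfAlgebra (t : ℂ) : HopfAlgebra ℂ (U t) where
  antipode := antipodeLin t
  mul_antipode_rTensor_comul := by
    ext a
    change LinearMap.mul' ℂ (U t) ((antipodeLin t).rTensor (U t) (comulHom t a)) =
      algebraMap ℂ (U t) (counitHom t a)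
    induction a using induction with
    | hs c => simp [Algebra.TensorProduct.algebraMap_apply, antipodeLin_algebraMap]
    | hg x => rw [comulHom, counitHom, lift_gen, lift_gen, left_gen]
    | hadd a b ha hb => rw [map_add, map_add, map_add, ha, hb, map_add, map_add]
    | hmul a b ha hb => rw [map_mul, left_mul t _ _ _ ha, hb, map_mul, map_mul, Algebra.smul_def]
  mul_antipode_lTensor_comul := by
    ext a
    change LinearMap.mul' ℂ (U t) ((antipodeLin t).lTensor (U t) (comulHom t a)) =
      algebraMap ℂ (U t) (counitHom t a)
    induction a using induction with
    | hs c =>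
      have h1 : antipodeLin t 1 = 1 := by simpa using antipodeLin_algebraMap t 1
      simp [Algebra.TensorProduct.algebraMap_apply, h1]
    | hg x => rw [comulHom, counitHom, lift_gen, lift_gen, right_gen]
    | hadd a b ha hb => rw [map_add, map_add, map_add, ha, hb, map_add, map_add]
    | hmul a b ha hb =>
      rw [map_mul, right_mul t _ _ _ hb, ha, map_mul, map_mul, Algebra.smul_def, Algebra.commutes]

/-! ### The vectors `λ^l_m` -/

/-- The `t`-number `[n] = (t^{2n} - t^{-2n}) / (t^2 - t^{-2})`. -/
def qNum (t : ℝ) (n : ℤ) : ℝ := (t ^ (2 * n) - t ^ (-2 * n)) / (t ^ 2 - (t ^ 2)⁻¹)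

/-- The `t`-factorial `[n]! = [1] [2] ⋯ [n]`. -/
def qFact (t : ℝ) (n : ℕ) : ℝ := ∏ i ∈ Finset.Icc 1 n, qNum t i

/-- `λ^l_m = ([l+m]! / ([2l]! [l-m]!))^{1/2} (ad f)^{l-m} (e^l k^{-l})`, for `-l ≤ m ≤ l`
(outside this range the value has no meaning). -/
def lam (t : ℝ) (l : ℕ) (m : ℤ) : U (t : ℂ) :=
  ((Real.sqrt (qFact t (l + m).toNat / (qFact t (2 * l) * qFact t (l - m).toNat)) : ℝ) : ℂ) •
    ((HopfAlgebra.ad ℂ (U (t : ℂ)) (f t)) ^ (l - m).toNat) (e t ^ l * kinv t ^ l)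

end QuantumSU2

end

noncomputable section

namespace QuantumSU2

open HopfAlgebra

/-! ### Explicit adjoint action and the nilpotency of `ad f` -/

section adjointAction

variable (t : ℂ)

/-! The vector v₀ = e^l k^{-l} is a highest weight vector: `ad e` kills it and `ad k` scales it by
t^{2l}. Its descendants v_j = (ad f)^j v₀ are weight vectors, and commuting `ad e` past `ad f` gives
ad_e v_{j+1} = [j+1][2l-j] v_j (`ad_e_ad_f_pow_highest`). The square-root normalisation then turns
these formulas into the stated symmetric ones.

Two facts are not formal. The string must stop, v_{2l+1} = 0 (`ad_f_pow_highest`): `ad f` is a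
twisted derivation, so nilpotency orders of factors combine as for ordinary derivations, and v₀ is
up to a scalar a product of l copies of e k^{-1}, each killed by (ad f)^3. And v₀ must be nonzero
(`highest_ne_zero`): instead of a PBW basis, a module is built on which e acts as an invertible
shift.

Since t is real with t² ≠ 1, every [n] with n > 0 is positive. Hence (ad e)^j carries v_j to a
nonzero multiple of v₀, so no v_j with j ≤ 2l vanishes; their `ad k`-eigenvalues are distinct, which
gives independence. Irreducibility uses the same descent: in a nonzero invariant subspace, a
suitable power of `ad e` brings some vector to a nonzero multiple of v₀, and `ad f` then recovers
everything. -/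

theorem comul_gen (x : Gen) : Coalgebra.comul (R := ℂ) (gen t x) = comulGen t x :=
  lift_gen (t := t) _ _ _ _ _ _ x

theorem antipode_gen (x : Gen) : antipode ℂ (gen t x) = antipodeGen t x :=
  antipodeLin_gen t x

theorem ad_gen (x : Gen) (b : U t) :
    ad ℂ (U t) (gen t x) b = conjEnd ℂ (U t) (comulGen t x) b := by
  rw [← comul_gen]
  rfl

theorem ad_e (b : U t) :
    ad ℂ (U t) (e t) b = e t * b * k t - (t ^ 2)⁻¹ • (k t * b * e t) := by
  rw [ad_gen, comulGen, map_add, LinearMap.add_apply, conjEnd_tmul, conjEnd_tmul, antipode_gen,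
    antipode_gen, antipodeGen, antipodeGen, mul_smul_comm, neg_smul, ← sub_eq_add_neg]

theorem ad_f (b : U t) :
    ad ℂ (U t) (f t) b = f t * b * k t - t ^ 2 • (k t * b * f t) := by
  rw [ad_gen, comulGen, map_add, LinearMap.add_apply, conjEnd_tmul, conjEnd_tmul, antipode_gen,
    antipode_gen, antipodeGen, antipodeGen, mul_smul_comm, neg_smul, ← sub_eq_add_neg]

theorem ad_k (b : U t) : ad ℂ (U t) (k t) b = k t * b * kinv t := by
  rw [ad_gen, comulGen, conjEnd_tmul, antipode_gen, antipodeGen]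

theorem ad_kinv (b : U t) : ad ℂ (U t) (kinv t) b = kinv t * b * k t := by
  rw [ad_gen, comulGen, conjEnd_tmul, antipode_gen, antipodeGen]

theorem k_mul_kinv_mul (x : U t) : k t * (kinv t * x) = x := by
  rw [← mul_assoc, k_mul_kinv, one_mul]

theorem kinv_mul_k_mul (x : U t) : kinv t * (k t * x) = x := by
  rw [← mul_assoc, kinv_mul_k, one_mul]

theorem k_mul_e_mul (x : U t) : k t * (e t * x) = t ^ 2 • (e t * (k t * x)) := by
  rw [← mul_assoc, k_mul_e, smul_mul_assoc, mul_assoc]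

theorem k_mul_f_mul (x : U t) : k t * (f t * x) = (t ^ 2)⁻¹ • (f t * (k t * x)) := by
  rw [← mul_assoc, k_mul_f, smul_mul_assoc, mul_assoc]

theorem kinv_mul_f_mul (x : U t) : kinv t * (f t * x) = t ^ 2 • (f t * (kinv t * x)) := by
  rw [← mul_assoc, kinv_mul_f, smul_mul_assoc, mul_assoc]

theorem e_mul_f : e t * f t =
    f t * e t + (t ^ 2 - (t ^ 2)⁻¹)⁻¹ • (k t * k t - kinv t * kinv t) := by
  rw [← pow_two, ← pow_two, ← e_mul_f_sub, add_sub_cancel]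

theorem e_mul_f_mul (x : U t) : e t * (f t * x) =
    f t * (e t * x) + (t ^ 2 - (t ^ 2)⁻¹)⁻¹ • (k t * (k t * x) - kinv t * (kinv t * x)) := by
  rw [← mul_assoc, e_mul_f]
  simp only [add_mul, smul_mul_assoc, sub_mul, mul_assoc]

variable {t}

/-- The adjoint action of `f` is a twisted derivation. -/
theorem ad_f_mul (x y : U t) :
    ad ℂ (U t) (f t) (x * y) =
      ad ℂ (U t) (f t) x * ad ℂ (U t) (kinv t) y + ad ℂ (U t) (k t) x * ad ℂ (U t) (f t) y := by
  simp only [ad_f, ad_k, ad_kinv, sub_mul, mul_sub, smul_mul_assoc, mul_smul_comm, mul_assoc,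
    k_mul_kinv_mul, kinv_mul_k_mul, kinv_mul_f_mul]
  abel

/-- The spin-one case, by direct computation: words are straightened so that f precedes e and e
precedes the powers of k, after which all coefficients cancel. -/
theorem ad_f_pow_three (ht : t ≠ 0) : (ad ℂ (U t) (f t) ^ 3) (e t * kinv t) = 0 := by
  simp only [pow_succ, pow_zero, one_mul, Module.End.mul_apply, ad_f, sub_mul, mul_sub, add_mul,
    mul_add, smul_mul_assoc, mul_smul_comm, smul_sub, smul_add, mul_assoc, k_mul_kinv_mul,
    kinv_mul_k_mul, k_mul_kinv, kinv_mul_k, k_mul_e_mul, k_mul_f_mul, k_mul_e,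
    k_mul_f, kinv_mul_f, e_mul_f, e_mul_f_mul, smul_smul, mul_one]
  match_scalars <;> field_simp <;> ring

theorem f_pow_mul_k (n : ℕ) : f t ^ n * k t = (t ^ 2) ^ n • (k t * f t ^ n) := by
  induction n with
  | zero => simp
  | succ n ih =>
    rw [pow_succ, mul_assoc, ← f_eq, mul_smul_comm, ← mul_assoc, ih, smul_mul_assoc, smul_smul,
      mul_assoc, ← pow_succ']

theorem f_pow_mul_kinv (n : ℕ) : f t ^ n * kinv t = (t ^ 2)⁻¹ ^ n • (kinv t * f t ^ n) := by
  induction n with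
  | zero => simp
  | succ n ih =>
    rw [pow_succ, mul_assoc, f_mul_kinv, mul_smul_comm, ← mul_assoc, ih, smul_mul_assoc,
      smul_smul, mul_assoc, ← pow_succ']

/-- f^n and k commute up to a scalar, so `ad k` preserves the kernel of (ad f)^n. This makes the
twists in `ad_f_mul` harmless. -/
theorem ad_f_pow_ad_k {x : U t} {n : ℕ} (h : (ad ℂ (U t) (f t) ^ n) x = 0) :
    (ad ℂ (U t) (f t) ^ n) (ad ℂ (U t) (k t) x) = 0 := by
  rw [← map_pow] at h ⊢
  rw [← Module.End.mul_apply, ← map_mul, f_pow_mul_k, map_smul, map_mul, LinearMap.smul_apply,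
    Module.End.mul_apply, h, map_zero, smul_zero]

theorem ad_f_pow_ad_kinv {x : U t} {n : ℕ} (h : (ad ℂ (U t) (f t) ^ n) x = 0) :
    (ad ℂ (U t) (f t) ^ n) (ad ℂ (U t) (kinv t) x) = 0 := by
  rw [← map_pow] at h ⊢
  rw [← Module.End.mul_apply, ← map_mul, f_pow_mul_kinv, map_smul, map_mul, LinearMap.smul_apply,
    Module.End.mul_apply, h, map_zero, smul_zero]

/-- Each application of the twisted Leibniz rule lowers the order a or b by one in each term, as in
the binomial argument for an ordinary derivation. Both factors vary in the induction because the
twists replace them by their images under `ad k` and `ad kinv`. -/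
theorem ad_f_pow_mul_eq_zero (n : ℕ) :
    ∀ (a b : ℕ) (x y : U t), a + b ≤ n + 1 → (ad ℂ (U t) (f t) ^ a) x = 0 →
      (ad ℂ (U t) (f t) ^ b) y = 0 → (ad ℂ (U t) (f t) ^ n) (x * y) = 0 := by
  induction n with
  | zero =>
    intro a b x y hab hx hy
    rcases Nat.eq_zero_or_pos a with rfl | ha
    · have : x = 0 := by simpa using hx
      simp [this]
    · obtain rfl : b = 0 := by omega
      have : y = 0 := by simpa using hy
      simp [this]
  | succ n ih =>
    intro a b x y hab hx hy
    rcases a with _ | a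
    · have : x = 0 := by simpa using hx
      simp [this]
    rcases b with _ | b
    · have : y = 0 := by simpa using hy
      simp [this]
    rw [pow_succ, Module.End.mul_apply, ad_f_mul, map_add,
      ih a (b + 1) _ _ (by omega) (by rwa [pow_succ, Module.End.mul_apply] at hx)
        (ad_f_pow_ad_kinv hy),
      ih (a + 1) b _ _ (by omega) (ad_f_pow_ad_k hx)
        (by rwa [pow_succ, Module.End.mul_apply] at hy), add_zero]

theorem k_mul_e_pow (l : ℕ) : k t * e t ^ l = (t ^ 2) ^ l • (e t ^ l * k t) := by
  induction l with
  | zero => simp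
  | succ n ih =>
    rw [pow_succ, ← mul_assoc, ih, smul_mul_assoc, mul_assoc, k_mul_e, mul_smul_comm, smul_smul,
      mul_assoc, ← pow_succ]

theorem kinv_pow_mul_e (l : ℕ) : kinv t ^ l * e t = ((t ^ 2)⁻¹) ^ l • (e t * kinv t ^ l) := by
  induction l with
  | zero => simp
  | succ n ih =>
    rw [pow_succ, mul_assoc, kinv_mul_e, mul_smul_comm, ← mul_assoc, ih, smul_mul_assoc,
      smul_smul, mul_assoc, ← pow_succ']

theorem ad_f_pow_highest (ht : t ≠ 0) (l : ℕ) :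
    (ad ℂ (U t) (f t) ^ (2 * l + 1)) (e t ^ l * kinv t ^ l) = 0 := by
  induction l with
  | zero => simp [ad_f, k_mul_f, smul_smul, mul_inv_cancel₀ (pow_ne_zero 2 ht)]
  | succ l ih =>
    -- Splitting off one factor e k^{-1} adds orders 2l + 1 and 3, whose sum 2l + 4 is exactly one
    -- more than the required power 2(l + 1) + 1.
    have h : e t ^ (l + 1) * kinv t ^ (l + 1) =
        (t ^ 2) ^ l • (e t ^ l * kinv t ^ l * (e t * kinv t)) := by
      rw [mul_assoc (e t ^ l), ← mul_assoc (kinv t ^ l), kinv_pow_mul_e, smul_mul_assoc,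
        mul_smul_comm, smul_smul, ← mul_pow, mul_inv_cancel₀ (pow_ne_zero 2 ht), one_pow,
        one_smul, pow_succ, pow_succ]
      simp only [mul_assoc]
    rw [h, map_smul, ad_f_pow_mul_eq_zero _ _ _ _ _ (by omega) ih (ad_f_pow_three ht),
      smul_zero]

theorem ad_k_highest (l : ℕ) :
    ad ℂ (U t) (k t) (e t ^ l * kinv t ^ l) = (t ^ 2) ^ l • (e t ^ l * kinv t ^ l) := by
  rw [ad_k, ← mul_assoc, k_mul_e_pow, smul_mul_assoc, smul_mul_assoc, mul_assoc, mul_assoc,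
    ← pow_succ, pow_succ' (kinv t), k_mul_kinv_mul]

theorem kinv_pow_mul_k (l : ℕ) : kinv t ^ l * k t = k t * kinv t ^ l :=
  (Commute.pow_left (show Commute (kinv t) (k t) from
    (kinv_mul_k t).trans (k_mul_kinv t).symm) l).eq

theorem ad_e_highest (ht : t ≠ 0) (l : ℕ) :
    ad ℂ (U t) (e t) (e t ^ l * kinv t ^ l) = 0 := by
  rw [ad_e, ← mul_assoc (k t), k_mul_e_pow, smul_mul_assoc, smul_mul_assoc,
    mul_assoc (e t ^ l * k t), kinv_pow_mul_e, mul_smul_comm, mul_assoc (e t ^ l), k_mul_e_mul,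
    mul_smul_comm, smul_smul, smul_smul, smul_smul, mul_assoc (e t), mul_assoc (e t ^ l),
    kinv_pow_mul_k, ← mul_assoc (e t), ← mul_assoc (e t ^ l), ← pow_succ, ← pow_succ', sub_eq_zero]
  rw [show (t ^ 2)⁻¹ * (t ^ 2) ^ l * (t ^ 2)⁻¹ ^ l * t ^ 2 = 1 by
    rw [mul_assoc _ ((t ^ 2) ^ l), ← mul_pow, mul_inv_cancel₀ (pow_ne_zero 2 ht), one_pow, mul_one,
      inv_mul_cancel₀ (pow_ne_zero 2 ht)], one_smul]

end adjointAction

/-! ### Weights and the action of `ad e` on the string -/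

section weights

variable {t : ℂ} (l : ℕ)

theorem ad_k_ad_f_pow (ht : t ≠ 0) (n : ℕ) (x : U t) :
    ad ℂ (U t) (k t) ((ad ℂ (U t) (f t) ^ n) x) =
      ((t ^ 2)⁻¹) ^ n • (ad ℂ (U t) (f t) ^ n) (ad ℂ (U t) (k t) x) := by
  rw [← map_pow, ← Module.End.mul_apply, ← Module.End.mul_apply, ← map_mul, ← map_mul,
    f_pow_mul_k, map_smul, LinearMap.smul_apply, smul_smul, ← mul_pow,
    inv_mul_cancel₀ (pow_ne_zero 2 ht), one_pow, one_smul]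

theorem ad_k_ad_f_pow_highest (ht : t ≠ 0) (j : ℕ) :
    ad ℂ (U t) (k t) ((ad ℂ (U t) (f t) ^ j) (e t ^ l * kinv t ^ l)) =
      t ^ (2 * ((l : ℤ) - j)) • (ad ℂ (U t) (f t) ^ j) (e t ^ l * kinv t ^ l) := by
  rw [ad_k_ad_f_pow ht, ad_k_highest, map_smul, smul_smul]
  congr 1
  rw [zpow_mul, zpow_sub₀ (zpow_ne_zero 2 ht), inv_pow, div_eq_mul_inv, mul_comm]
  norm_cast

theorem ad_kinv_of_ad_k {x : U t} {c : ℂ} (hc : c ≠ 0) (h : ad ℂ (U t) (k t) x = c • x) :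
    ad ℂ (U t) (kinv t) x = c⁻¹ • x := by
  have h2 : ad ℂ (U t) (kinv t) (ad ℂ (U t) (k t) x) = x := by
    rw [← Module.End.mul_apply, ← map_mul, kinv_mul_k, map_one, Module.End.one_apply]
  rw [h, map_smul] at h2
  rw [eq_inv_smul_iff₀ hc, h2]

theorem ad_e_ad_f (x : U t) :
    ad ℂ (U t) (e t) (ad ℂ (U t) (f t) x) = ad ℂ (U t) (f t) (ad ℂ (U t) (e t) x) +
      (t ^ 2 - (t ^ 2)⁻¹)⁻¹ • (ad ℂ (U t) (k t) (ad ℂ (U t) (k t) x) -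
        ad ℂ (U t) (kinv t) (ad ℂ (U t) (kinv t) x)) := by
  have h := congrArg (fun a => ad ℂ (U t) a x) (e_mul_f t)
  simpa only [map_add, map_smul, map_sub, map_mul, LinearMap.add_apply, LinearMap.smul_apply,
    LinearMap.sub_apply, Module.End.mul_apply] using h

/-- The complex `t`-number. -/
def cNum (t : ℂ) (n : ℤ) : ℂ := (t ^ (2 * n) - t ^ (-2 * n)) / (t ^ 2 - (t ^ 2)⁻¹)

/-- With a = j and b = 2l this is the recursion for the coefficients of `ad e` along the string; [b
- 2a] is the contribution of the commutator [e, f]. -/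
theorem cNum_succ_mul (ht : t ≠ 0) (a b : ℤ) :
    cNum t a * cNum t (b - a + 1) + cNum t (b - 2 * a) = cNum t (a + 1) * cNum t (b - a) := by
  by_cases hd : t ^ 2 - (t ^ 2)⁻¹ = 0
  · simp [cNum, hd]
  unfold cNum
  rw [div_mul_div_comm, div_mul_div_comm,
    ← mul_div_mul_right (t ^ (2 * (b - 2 * a)) - t ^ (-2 * (b - 2 * a))) _ hd, ← add_div]
  congr 1
  -- Every power is expressed through t^{2a}, t^{2b} and t², leaving a rational identity in
  -- independent variables.
  have e1 : t ^ (-2 * a) = (t ^ (2 * a))⁻¹ := by rw [← zpow_neg]; congr 1; ring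
  have e2 : t ^ (2 * (b - a + 1)) = t ^ (2 * b) * (t ^ (2 * a))⁻¹ * t ^ 2 := by
    rw [← zpow_neg, ← zpow_natCast t 2, ← zpow_add₀ ht, ← zpow_add₀ ht]; congr 1; push_cast; ring
  have e3 : t ^ (-2 * (b - a + 1)) = (t ^ (2 * b) * (t ^ (2 * a))⁻¹ * t ^ 2)⁻¹ := by
    rw [← e2, ← zpow_neg]; congr 1; ring
  have e4 : t ^ (2 * (b - 2 * a)) = t ^ (2 * b) * (t ^ (2 * a))⁻¹ * (t ^ (2 * a))⁻¹ := by
    rw [← zpow_neg, ← zpow_add₀ ht, ← zpow_add₀ ht]; congr 1; ring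
  have e5 : t ^ (-2 * (b - 2 * a)) = (t ^ (2 * b) * (t ^ (2 * a))⁻¹ * (t ^ (2 * a))⁻¹)⁻¹ := by
    rw [← e4, ← zpow_neg]; congr 1; ring
  have e6 : t ^ (2 * (a + 1)) = t ^ (2 * a) * t ^ 2 := by
    rw [← zpow_natCast t 2, ← zpow_add₀ ht]; congr 1; push_cast; ring
  have e7 : t ^ (-2 * (a + 1)) = (t ^ (2 * a) * t ^ 2)⁻¹ := by
    rw [← e6, ← zpow_neg]; congr 1; ring
  have e8 : t ^ (2 * (b - a)) = t ^ (2 * b) * (t ^ (2 * a))⁻¹ := by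
    rw [← zpow_neg, ← zpow_add₀ ht]; congr 1; ring
  have e9 : t ^ (-2 * (b - a)) = (t ^ (2 * b) * (t ^ (2 * a))⁻¹)⁻¹ := by
    rw [← e8, ← zpow_neg]; congr 1; ring
  rw [e1, e2, e3, e4, e5, e6, e7, e8, e9]
  have h1 := zpow_ne_zero (2 * a) ht
  have h2 := zpow_ne_zero (2 * b) ht
  generalize t ^ (2 * a) = x at *
  generalize t ^ (2 * b) = y at *
  field_simp
  ring

theorem inv_mul_sub_inv_eq_cNum (ht : t ≠ 0) (w : ℤ) :
    (t ^ 2 - (t ^ 2)⁻¹)⁻¹ *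
      (t ^ (2 * w) * t ^ (2 * w) - (t ^ (2 * w))⁻¹ * (t ^ (2 * w))⁻¹) = cNum t (2 * w) := by
  rw [cNum, div_eq_inv_mul, ← zpow_neg, ← zpow_add₀ ht, ← zpow_add₀ ht]
  congr 3 <;> ring_nf

theorem ad_e_ad_f_pow_highest (ht : t ≠ 0) (j : ℕ) :
    ad ℂ (U t) (e t) ((ad ℂ (U t) (f t) ^ (j + 1)) (e t ^ l * kinv t ^ l)) =
      (cNum t (j + 1) * cNum t (2 * l - j)) •
        (ad ℂ (U t) (f t) ^ j) (e t ^ l * kinv t ^ l) := by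
  induction j with
  | zero =>
    rw [zero_add, pow_one, ad_e_ad_f, ad_e_highest ht, map_zero, zero_add]
    have h := ad_k_ad_f_pow_highest l ht 0
    rw [pow_zero, Module.End.one_apply] at h ⊢
    have h' := ad_kinv_of_ad_k (zpow_ne_zero _ ht) h
    rw [h, h', map_smul, map_smul, h, h', smul_smul, smul_smul, ← sub_smul, smul_smul]
    congr 1
    -- At a = 0 the identity reads [2l] = [1][2l], which avoids evaluating [1] and so needs no
    -- condition on the denominator.
    have h0 := cNum_succ_mul ht 0 (2 * l)
    have h1 : cNum t 0 = 0 := by simp [cNum]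
    rw [h1, zero_mul, zero_add] at h0
    rw [inv_mul_sub_inv_eq_cNum ht, Nat.cast_zero, ← h0]
    congr 1
  | succ j ih =>
    rw [pow_succ' _ (j + 1), Module.End.mul_apply, ad_e_ad_f, ih, map_smul,
      ← Module.End.mul_apply, ← pow_succ']
    have h := ad_k_ad_f_pow_highest l ht (j + 1)
    have h' := ad_kinv_of_ad_k (zpow_ne_zero _ ht) h
    rw [h, h', map_smul, map_smul, h, h', smul_smul, smul_smul, ← sub_smul, smul_smul, ← add_smul]
    congr 1
    have h0 := cNum_succ_mul ht (j + 1) (2 * l)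
    rw [inv_mul_sub_inv_eq_cNum ht]
    push_cast
    rw [← h0]
    congr 3 <;> ring

end weights

/-! ### A module detecting that powers of e are nonzero -/

/-- The weights of the backward shift by which `f` acts on functions `ℤ → ℂ`. -/
def shiftCoeff (t : ℂ) (n : ℤ) : ℂ :=
  (t ^ 2 - (t ^ 2)⁻¹)⁻¹ * (t ^ (4 * n) / ((t ^ 4)⁻¹ - 1) - t ^ (-4 * n) / (t ^ 4 - 1))

/-- The weighted shifts on functions `ℤ → ℂ` giving a module on which `e` is invertible. -/
def shiftGen (t : ℂ) : Gen → Module.End ℂ (ℤ → ℂ)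
  | Gen.e => LinearMap.funLeft ℂ ℂ (fun n => n - 1)
  | Gen.f => LinearMap.pi fun n => shiftCoeff t n • LinearMap.proj (n + 1)
  | Gen.k => LinearMap.pi fun n => t ^ (2 * n) • LinearMap.proj n
  | Gen.kinv => LinearMap.pi fun n => t ^ (-2 * n) • LinearMap.proj n

/-- The module of functions `ℤ → ℂ` over `U t`. -/
def shiftRep {t : ℂ} (ht : t ≠ 0) (ht4 : t ^ 4 ≠ 1) : U t →ₐ[ℂ] Module.End ℂ (ℤ → ℂ) :=
  lift (shiftGen t)
    (by
      ext φ n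
      change t ^ (2 * n) * (t ^ (-2 * n) * φ n) = φ n
      rw [← mul_assoc, ← zpow_add₀ ht]
      simp)
    (by
      ext φ n
      change t ^ (-2 * n) * (t ^ (2 * n) * φ n) = φ n
      rw [← mul_assoc, ← zpow_add₀ ht]
      simp)
    (by
      ext φ n
      change t ^ (2 * n) * φ (n - 1) = t ^ 2 * (t ^ (2 * (n - 1)) * φ (n - 1))
      rw [← mul_assoc, ← zpow_natCast t 2, ← zpow_add₀ ht]
      congr 2
      push_cast
      ring)
    (by
      ext φ n
      change t ^ (2 * n) * (shiftCoeff t n * φ (n + 1)) =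
        (t ^ 2)⁻¹ * (shiftCoeff t n * (t ^ (2 * (n + 1)) * φ (n + 1)))
      rw [show 2 * (n + 1) = 2 * n + (2 : ℕ) by push_cast; ring, zpow_add₀ ht, zpow_natCast]
      field_simp)
    (by
      ext φ n
      change shiftCoeff t (n - 1) * φ (n - 1 + 1) - shiftCoeff t n * φ (n + 1 - 1) =
        (t ^ 2 - (t ^ 2)⁻¹)⁻¹ * ((shiftGen t Gen.k ^ 2) φ n - (shiftGen t Gen.kinv ^ 2) φ n)
      rw [pow_two (shiftGen t Gen.k), pow_two (shiftGen t Gen.kinv)]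
      change shiftCoeff t (n - 1) * φ (n - 1 + 1) - shiftCoeff t n * φ (n + 1 - 1) = (t ^ 2 - (t ^ 2)⁻¹)⁻¹ * (t ^ (2 * n) * (t ^ (2 * n) * φ n) -
        t ^ (-2 * n) * (t ^ (-2 * n) * φ n))
      rw [sub_add_cancel, add_sub_cancel_right, ← sub_mul, ← mul_assoc, ← mul_assoc (t ^ (-2 * n)),
        ← sub_mul, ← mul_assoc]
      congr 1
      -- What remains is a first-order difference equation for `shiftCoeff`, whose right side is a
      -- combination of t^{4n} and t^{-4n}; the coefficient is its geometric solution, which exists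
      -- because t⁴ ≠ 1.
      have h1 : t ^ 4 - 1 ≠ 0 := sub_ne_zero.mpr ht4
      have h2 : (t ^ 4)⁻¹ - 1 ≠ 0 := by
        rw [sub_ne_zero, Ne, inv_eq_one]
        exact ht4
      have e1 : t ^ (4 * n) = t ^ (2 * n) * t ^ (2 * n) := by rw [← zpow_add₀ ht]; congr 1; ring
      have e2 : t ^ (4 * (n - 1)) = t ^ (2 * n) * t ^ (2 * n) * (t ^ 4)⁻¹ := by
        rw [← zpow_natCast t 4, ← zpow_neg, ← zpow_add₀ ht, ← zpow_add₀ ht]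
        congr 1; push_cast; ring
      have e3 : t ^ (-4 * n) = (t ^ (2 * n) * t ^ (2 * n))⁻¹ := by
        rw [← e1, ← zpow_neg]; congr 1; ring
      have e4 : t ^ (-4 * (n - 1)) = (t ^ (2 * n) * t ^ (2 * n) * (t ^ 4)⁻¹)⁻¹ := by
        rw [← e2, ← zpow_neg]; congr 1; ring
      have e5 : t ^ (-2 * n) = (t ^ (2 * n))⁻¹ := by rw [← zpow_neg]; congr 1; ring
      unfold shiftCoeff
      rw [e1, e2, e3, e4, e5, ← mul_sub]
      congr 1
      have h3 := zpow_ne_zero (2 * n) ht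
      have h4 : 1 - t ^ 4 ≠ 0 := sub_ne_zero.mpr ht4.symm
      rw [show (t ^ 4)⁻¹ - 1 = - (t ^ 4 - 1) / t ^ 4 by field_simp; ring]
      generalize t ^ (2 * n) = x at *
      field_simp
      ring)

/-- As k is invertible, only e^l matters. In the shift module e fixes the constant function 1, so no
power of e is zero. -/
theorem highest_ne_zero {t : ℂ} (ht : t ≠ 0) (ht4 : t ^ 4 ≠ 1) (l : ℕ) :
    e t ^ l * kinv t ^ l ≠ 0 := by
  intro h
  have hk : kinv t ^ l * k t ^ l = 1 := by
    rw [← (show Commute (kinv t) (k t) from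
      (kinv_mul_k t).trans (k_mul_kinv t).symm).mul_pow, kinv_mul_k, one_pow]
  have he : e t ^ l = 0 := by
    rw [← mul_one (e t ^ l), ← hk, ← mul_assoc, h, zero_mul]
  have hE : ∀ n : ℕ, (shiftGen t Gen.e ^ n) 1 = 1 := by
    intro n
    induction n with
    | zero => rfl
    | succ n ih => rw [pow_succ, Module.End.mul_apply]; exact ih
  have := congrArg (fun x => shiftRep ht ht4 x 1 0) he
  simp [map_pow, shiftRep, lift_gen, hE] at this

/-! ### The span of the string and its irreducibility -/

section descendants

variable {t : ℂ} (l : ℕ)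

/-- The `j`-th descendant `(ad f)^j (e^l k^{-l})` of the highest weight vector. -/
def descendant (t : ℂ) (l j : ℕ) : U t :=
  (ad ℂ (U t) (f t) ^ j) (e t ^ l * kinv t ^ l)

theorem ad_f_descendant (j : ℕ) :
    ad ℂ (U t) (f t) (descendant t l j) = descendant t l (j + 1) := by
  rw [descendant, descendant, pow_succ', Module.End.mul_apply]

theorem descendant_eq_zero (ht : t ≠ 0) : descendant t l (2 * l + 1) = 0 :=
  ad_f_pow_highest ht l

theorem ad_e_descendant_zero (ht : t ≠ 0) : ad ℂ (U t) (e t) (descendant t l 0) = 0 := by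
  simpa [descendant] using ad_e_highest ht l

theorem ad_e_descendant_succ (ht : t ≠ 0) (j : ℕ) :
    ad ℂ (U t) (e t) (descendant t l (j + 1)) =
      (cNum t (j + 1) * cNum t (2 * l - j)) • descendant t l j :=
  ad_e_ad_f_pow_highest l ht j

theorem ad_k_descendant (ht : t ≠ 0) (j : ℕ) :
    ad ℂ (U t) (k t) (descendant t l j) = t ^ (2 * ((l : ℤ) - j)) • descendant t l j :=
  ad_k_ad_f_pow_highest l ht j

theorem ad_kinv_descendant (ht : t ≠ 0) (j : ℕ) :
    ad ℂ (U t) (kinv t) (descendant t l j) = t ^ (-2 * ((l : ℤ) - j)) • descendant t l j := by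
  rw [ad_kinv_of_ad_k (zpow_ne_zero _ ht) (ad_k_descendant l ht j), ← zpow_neg, neg_mul]

/-- The span of the first `n` descendants. -/
def descSpan (t : ℂ) (l n : ℕ) : Submodule ℂ (U t) :=
  Submodule.span ℂ (descendant t l '' Set.Iio n)

theorem descendant_mem {j n : ℕ} (h : j < n) : descendant t l j ∈ descSpan t l n :=
  Submodule.subset_span ⟨j, h, rfl⟩

theorem descSpan_succ (n : ℕ) :
    descSpan t l (n + 1) = Submodule.span ℂ {descendant t l n} ⊔ descSpan t l n := by
  rw [descSpan, descSpan, ← Submodule.span_union, Set.singleton_union, ← Set.image_insert_eq]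
  congr 2
  ext i
  simp only [Set.mem_Iio, Set.mem_insert_iff]
  omega

/-- Stability passes to sums and products, so generators suffice; only f at the end of the string
could leave the span, and there v_{2l+1} = 0. -/
theorem ad_mem_descSpan (ht : t ≠ 0) (a : U t) :
    ∀ x ∈ descSpan t l (2 * l + 1), ad ℂ (U t) a x ∈ descSpan t l (2 * l + 1) := by
  induction a using induction with
  | hs c =>
    intro x hx
    rw [AlgHom.commutes, Module.algebraMap_end_apply]
    exact Submodule.smul_mem _ _ hx
  | hadd a b ha hb =>
    intro x hx
    rw [map_add, LinearMap.add_apply]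
    exact Submodule.add_mem _ (ha x hx) (hb x hx)
  | hmul a b ha hb =>
    intro x hx
    rw [map_mul, Module.End.mul_apply]
    exact ha _ (hb x hx)
  | hg g =>
    suffices h : descSpan t l (2 * l + 1) ≤
        (descSpan t l (2 * l + 1)).comap (ad ℂ (U t) (gen t g)) from h
    conv_lhs => rw [descSpan]
    rw [Submodule.span_le]
    rintro _ ⟨j, hj, rfl⟩
    change ad ℂ (U t) (gen t g) (descendant t l j) ∈ descSpan t l (2 * l + 1)
    rw [Set.mem_Iio] at hj
    cases g with
    | e =>
      rcases j with _ | j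
      · rw [ad_e_descendant_zero l ht]
        exact Submodule.zero_mem _
      · rw [ad_e_descendant_succ l ht]
        exact Submodule.smul_mem _ _ (descendant_mem l (by omega))
    | f =>
      rw [ad_f_descendant]
      rcases Nat.lt_or_ge (j + 1) (2 * l + 1) with h | h
      · exact descendant_mem l h
      · rw [show j + 1 = 2 * l + 1 by omega, descendant_eq_zero l ht]
        exact Submodule.zero_mem _
    | k =>
      rw [ad_k_descendant l ht]
      exact Submodule.smul_mem _ _ (descendant_mem l hj)
    | kinv =>
      rw [ad_kinv_descendant l ht]
      exact Submodule.smul_mem _ _ (descendant_mem l hj)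

theorem ad_e_mem_descSpan (ht : t ≠ 0) (n : ℕ) :
    ∀ x ∈ descSpan t l (n + 1), ad ℂ (U t) (e t) x ∈ descSpan t l n := by
  suffices h : descSpan t l (n + 1) ≤ (descSpan t l n).comap (ad ℂ (U t) (e t)) from h
  conv_lhs => rw [descSpan]
  rw [Submodule.span_le]
  rintro _ ⟨j, hj, rfl⟩
  change ad ℂ (U t) (e t) (descendant t l j) ∈ descSpan t l n
  rw [Set.mem_Iio] at hj
  rcases j with _ | j
  · rw [ad_e_descendant_zero l ht]
    exact Submodule.zero_mem _
  · rw [ad_e_descendant_succ l ht]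
    exact Submodule.smul_mem _ _ (descendant_mem l (by omega))

theorem ad_e_pow_eq_zero (ht : t ≠ 0) (n : ℕ) :
    ∀ x ∈ descSpan t l n, (ad ℂ (U t) (e t) ^ n) x = 0 := by
  induction n with
  | zero =>
    intro x hx
    simpa [descSpan] using hx
  | succ n ih =>
    intro x hx
    rw [pow_succ, Module.End.mul_apply]
    exact ih _ (ad_e_mem_descSpan l ht n x hx)

variable (hc : ∀ n : ℤ, 0 < n → cNum t n ≠ 0)
include hc

/-- The constant is a product of factors [i+1][2l-i] with i < n ≤ 2l, all of positive index and
hence nonzero by `hc`. -/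
theorem ad_e_pow_descendant (ht : t ≠ 0) (n : ℕ) (hn : n ≤ 2 * l) :
    ∃ c : ℂ, c ≠ 0 ∧ (ad ℂ (U t) (e t) ^ n) (descendant t l n) = c • descendant t l 0 := by
  induction n with
  | zero => exact ⟨1, one_ne_zero, by simp⟩
  | succ n ih =>
    obtain ⟨c, h0, h⟩ := ih (by omega)
    refine ⟨cNum t (n + 1) * cNum t (2 * l - n) * c,
      mul_ne_zero (mul_ne_zero (hc _ (by omega)) (hc _ (by omega))) h0, ?_⟩
    rw [pow_succ, Module.End.mul_apply, ad_e_descendant_succ l ht, map_smul, h, smul_smul]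

/-- Induction on the length of x: if its top coefficient, at v_n, is nonzero, then (ad e)^n kills
all lower terms and leaves a nonzero multiple of v₀; otherwise x is shorter. Linear independence of
the v_j is not needed. -/
theorem descendant_zero_mem (ht : t ≠ 0) (N : Submodule ℂ (U t))
    (he : ∀ x ∈ N, ad ℂ (U t) (e t) x ∈ N) (n : ℕ) (hn : n ≤ 2 * l + 1) :
    ∀ x ∈ N, x ∈ descSpan t l n → x ≠ 0 → descendant t l 0 ∈ N := by
  induction n with
  | zero =>
    intro x _ hx h0
    exact absurd (by simpa [descSpan] using hx) h0
  | succ n ih =>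
    intro x hN hx h0
    rw [descSpan_succ, Submodule.mem_sup] at hx
    obtain ⟨y, hy, z, hz, rfl⟩ := hx
    obtain ⟨a, rfl⟩ := Submodule.mem_span_singleton.mp hy
    by_cases ha : a = 0
    · refine ih (by omega) _ hN ?_ h0
      simpa [ha] using hz
    · obtain ⟨c, h1, h2⟩ := ad_e_pow_descendant l hc ht n (by omega)
      have hpow : ∀ i : ℕ, ∀ x ∈ N, (ad ℂ (U t) (e t) ^ i) x ∈ N := by
        intro i
        induction i with
        | zero => intro x hx; simpa using hx
        | succ i ih => intro x hx; rw [pow_succ, Module.End.mul_apply]; exact ih _ (he x hx)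
      have h3 := hpow n _ hN
      rw [map_add, map_smul, h2, ad_e_pow_eq_zero l ht n z hz, add_zero, smul_smul] at h3
      exact (Submodule.smul_mem_iff _ (mul_ne_zero ha h1)).mp h3

theorem descSpan_le (ht : t ≠ 0) (N : Submodule ℂ (U t)) (hN : N ≤ descSpan t l (2 * l + 1))
    (he : ∀ x ∈ N, ad ℂ (U t) (e t) x ∈ N) (hf : ∀ x ∈ N, ad ℂ (U t) (f t) x ∈ N)
    (h0 : N ≠ ⊥) : descSpan t l (2 * l + 1) ≤ N := by
  obtain ⟨x, hx, hx0⟩ := Submodule.exists_mem_ne_zero_of_ne_bot h0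
  have h := descendant_zero_mem l hc ht N he _ le_rfl x hx (hN hx) hx0
  have hall : ∀ j, descendant t l j ∈ N := by
    intro j
    induction j with
    | zero => exact h
    | succ j ih => rw [← ad_f_descendant]; exact hf _ ih
  rw [descSpan, Submodule.span_le]
  rintro _ ⟨j, -, rfl⟩
  exact hall j

theorem descendant_ne_zero (ht : t ≠ 0) (ht4 : t ^ 4 ≠ 1) (n : ℕ) (hn : n ≤ 2 * l) :
    descendant t l n ≠ 0 := by
  intro h
  obtain ⟨c, h1, h2⟩ := ad_e_pow_descendant l hc ht n hn
  rw [h, map_zero] at h2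
  refine highest_ne_zero ht ht4 l ?_
  simpa [descendant, h1] using h2.symm

/-- The descendants span an irreducible subrepresentation of the adjoint representation. -/
theorem isIrreducible_of_descSpan (ht : t ≠ 0) (ht4 : t ^ 4 ≠ 1)
    (W : Subrepresentation (adRep ℂ (U t))) (hW : W.toSubmodule = descSpan t l (2 * l + 1)) :
    W.toRepresentation.IsIrreducible := by
  have hv : descendant t l 0 ∈ W.toSubmodule := by
    rw [hW]
    exact descendant_mem l (by omega)
  have hv0 := descendant_ne_zero l hc ht ht4 0 (by omega)
  refine { exists_pair_ne := ⟨⊥, ⊤, fun h => hv0 ?_⟩, eq_bot_or_eq_top := fun N => ?_ }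
  · have h1 : (⟨_, hv⟩ : W.toSubmodule) ∈ (⊤ : Subrepresentation W.toRepresentation).toSubmodule :=
      Submodule.mem_top
    rw [← h] at h1
    exact congrArg Subtype.val ((Submodule.mem_bot ℂ).mp h1)
  · by_cases h0 : N.toSubmodule = ⊥
    · exact Or.inl (Subrepresentation.toSubmodule_injective h0)
    right
    apply Subrepresentation.toSubmodule_injective
    change N.toSubmodule = ⊤
    -- A subrepresentation of W is pushed forward into the whole algebra, where `descSpan_le`
    -- applies.
    have hst : ∀ a : U t, ∀ x ∈ N.toSubmodule.map W.toSubmodule.subtype,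
        ad ℂ (U t) a x ∈ N.toSubmodule.map W.toSubmodule.subtype := by
      rintro a _ ⟨y, hy, rfl⟩
      exact ⟨_, N.apply_mem_toSubmodule a hy, rfl⟩
    have hle := descSpan_le l hc ht (N.toSubmodule.map W.toSubmodule.subtype)
      (by rw [← hW]; exact Submodule.map_subtype_le _ _) (hst _) (hst _)
      (by rwa [Ne, (Submodule.map_injective_of_injective W.toSubmodule.injective_subtype).eq_iff'
        (Submodule.map_bot _)])
    rw [← hW] at hle
    rw [eq_top_iff]
    rintro x -
    obtain ⟨y, hy, hxy⟩ := hle x.2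
    rwa [Subtype.ext hxy] at hy

end descendants

/-! ### Real parameter: positivity and normalisation -/

section real

variable {t : ℝ}

theorem cNum_ofReal (t : ℝ) (n : ℤ) : cNum (t : ℂ) n = (qNum t n : ℂ) := by
  simp [cNum, qNum]

theorem qNum_zero (t : ℝ) : qNum t 0 = 0 := by simp [qNum]

theorem sq_ne_one_of_ne (ht1 : t ≠ 1) (ht2 : t ≠ -1) : t ^ 2 ≠ 1 := fun h =>
  (sq_eq_sq_iff_eq_or_eq_neg.mp (h.trans (one_pow 2).symm)).elim ht1 ht2

/-- With q = t² > 0, numerator and denominator are q^n - q^{-n} and q^1 - q^{-1}. Strict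
monotonicity of the powers of q gives both the same sign, negative for q < 1 and positive for q > 1.
-/
theorem qNum_pos (ht0 : t ≠ 0) (ht : t ^ 2 ≠ 1) {n : ℤ} (hn : 0 < n) : 0 < qNum t n := by
  have hq : 0 < t ^ 2 := by positivity
  have e1 : t ^ (2 * n) = (t ^ 2) ^ n := by rw [zpow_mul]; rfl
  have e2 : t ^ (-2 * n) = (t ^ 2) ^ (-n) := by
    rw [show -2 * n = 2 * -n by ring, zpow_mul]; rfl
  have e3 : (t ^ 2)⁻¹ = (t ^ 2) ^ (-1 : ℤ) := by rw [zpow_neg_one]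
  rw [qNum, e1, e2, e3]
  generalize t ^ 2 = q at *
  nth_rewrite 3 [← zpow_one q]
  rcases lt_or_gt_of_ne ht with h | h
  · have hs := zpow_right_strictAnti₀ hq h
    exact div_pos_of_neg_of_neg (sub_neg.mpr (hs (by omega))) (sub_neg.mpr (hs (by omega)))
  · have hs := zpow_right_strictMono₀ h
    exact div_pos (sub_pos.mpr (hs (by omega))) (sub_pos.mpr (hs (by omega)))

theorem qFact_succ (t : ℝ) (n : ℕ) : qFact t (n + 1) = qFact t n * qNum t (n + 1) := by
  rw [qFact, qFact, Finset.prod_Icc_succ_top (by omega)]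
  push_cast
  rfl

theorem qFact_pos (ht0 : t ≠ 0) (ht : t ^ 2 ≠ 1) (n : ℕ) : 0 < qFact t n := by
  refine Finset.prod_pos fun i hi => qNum_pos ht0 ht ?_
  have := (Finset.mem_Icc.mp hi).1
  omega

/-- Replacing m by the natural numbers j = l - m and p = l + m removes the truncations `toNat` and
exposes the descendant. -/
theorem lam_eq (t : ℝ) {l j p : ℕ} {m : ℤ} (hm : m = l - j) (hp : j + p = 2 * l) :
    lam t l m = ((Real.sqrt (qFact t p / (qFact t (2 * l) * qFact t j)) : ℝ) : ℂ) •
      descendant (t : ℂ) l j := by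
  rw [lam, descendant, show (l + m).toNat = p by omega, show (l - m).toNat = j by omega]

theorem ad_f_lam (ht0 : t ≠ 0) (ht : t ^ 2 ≠ 1) {l j p : ℕ} {m : ℤ} (hm : m = l - j)
    (hp : j + p = 2 * l) :
    ad ℂ (U t) (f t) (lam t l m) =
      ((Real.sqrt (qNum t (l + m) * qNum t (l - m + 1)) : ℝ) : ℂ) • lam t l (m - 1) := by
  have htc : (t : ℂ) ≠ 0 := by exact_mod_cast ht0
  rw [lam_eq t hm hp, map_smul, ad_f_descendant, show (l : ℤ) + m = p by omega,
    show (l : ℤ) - m = j by omega]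
  rcases p with _ | p
  · rw [show j + 1 = 2 * l + 1 by omega, descendant_eq_zero l htc, Nat.cast_zero, qNum_zero,
      zero_mul, Real.sqrt_zero, Complex.ofReal_zero, zero_smul, smul_zero]
  · rw [lam_eq t (m := m - 1) (j := j + 1) (p := p) (by push_cast; omega) (by omega), smul_smul,
      ← Complex.ofReal_mul]
    congr 2
    have hA := qNum_pos ht0 ht (n := p + 1) (by omega)
    have hB := qNum_pos ht0 ht (n := j + 1) (by omega)
    have h1 := qFact_pos ht0 ht p
    have h2 := qFact_pos ht0 ht j
    have h3 := qFact_pos ht0 ht (2 * l)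
    push_cast
    rw [← Real.sqrt_mul (mul_pos hA hB).le, qFact_succ, qFact_succ]
    congr 1
    field_simp

theorem ad_e_lam (ht0 : t ≠ 0) (ht : t ^ 2 ≠ 1) {l j p : ℕ} {m : ℤ} (hm : m = l - j)
    (hp : j + p = 2 * l) :
    ad ℂ (U t) (e t) (lam t l m) =
      ((Real.sqrt (qNum t (l - m) * qNum t (l + m + 1)) : ℝ) : ℂ) • lam t l (m + 1) := by
  have htc : (t : ℂ) ≠ 0 := by exact_mod_cast ht0
  rw [lam_eq t hm hp, map_smul, show (l : ℤ) + m = p by omega, show (l : ℤ) - m = j by omega]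
  rcases j with _ | j
  -- At m = l the coefficient contains [0] = 0, so the meaningless value of `lam` at l + 1 plays no
  -- role.
  · rw [ad_e_descendant_zero l htc, Nat.cast_zero, qNum_zero,
      zero_mul, Real.sqrt_zero, Complex.ofReal_zero, zero_smul, smul_zero]
  · rw [lam_eq t (m := m + 1) (j := j) (p := p + 1) (by push_cast at hm; omega) (by omega),
      ad_e_descendant_succ l htc, smul_smul, smul_smul, cNum_ofReal, cNum_ofReal,
      show 2 * (l : ℤ) - j = p + 1 by omega, ← Complex.ofReal_mul, ← Complex.ofReal_mul,
      ← Complex.ofReal_mul]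
    congr 2
    have hA := qNum_pos ht0 ht (n := p + 1) (by omega)
    have hB := qNum_pos ht0 ht (n := j + 1) (by omega)
    have h1 := qFact_pos ht0 ht p
    have h2 := qFact_pos ht0 ht j
    have h3 := qFact_pos ht0 ht (2 * l)
    push_cast
    -- The factor [j+1][p+1] is written as the square root of its square, so that each side becomes
    -- a single square root and the radicands can be compared.
    rw [← Real.sqrt_mul (mul_pos hB hA).le, ← Real.sqrt_mul_self (mul_pos hB hA).le,
      ← Real.sqrt_mul (by rw [qFact_succ]; positivity), Real.sqrt_mul_self (mul_pos hB hA).le,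
      qFact_succ, qFact_succ]
    congr 1
    field_simp

theorem exists_nat_index {l : ℕ} {m : ℤ} (h1 : -(l : ℤ) ≤ m) (h2 : m ≤ l) :
    ∃ j p : ℕ, m = l - j ∧ j + p = 2 * l :=
  ⟨(l - m).toNat, (l + m).toNat, by omega, by omega⟩

theorem ad_k_lam (ht0 : t ≠ 0) {l : ℕ} {m : ℤ} (h1 : -(l : ℤ) ≤ m) (h2 : m ≤ l) :
    ad ℂ (U t) (k t) (lam t l m) = ((t : ℂ) ^ (2 * m)) • lam t l m := by
  obtain ⟨j, p, hm, hp⟩ := exists_nat_index h1 h2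
  rw [lam_eq t hm hp, map_smul, ad_k_descendant l (by exact_mod_cast ht0), smul_comm, hm]

theorem ad_kinv_lam (ht0 : t ≠ 0) {l : ℕ} {m : ℤ} (h1 : -(l : ℤ) ≤ m) (h2 : m ≤ l) :
    ad ℂ (U t) (kinv t) (lam t l m) = ((t : ℂ) ^ (-2 * m)) • lam t l m := by
  obtain ⟨j, p, hm, hp⟩ := exists_nat_index h1 h2
  rw [lam_eq t hm hp, map_smul, ad_kinv_descendant l (by exact_mod_cast ht0), smul_comm, hm]

theorem lam_coeff_ne_zero (ht0 : t ≠ 0) (ht : t ^ 2 ≠ 1) (l j p : ℕ) :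
    ((Real.sqrt (qFact t p / (qFact t (2 * l) * qFact t j)) : ℝ) : ℂ) ≠ 0 := by
  have h1 := qFact_pos ht0 ht p
  have h2 := qFact_pos ht0 ht j
  have h3 := qFact_pos ht0 ht (2 * l)
  exact_mod_cast (Real.sqrt_pos.mpr (by positivity)).ne'

theorem cNum_ne_zero (ht0 : t ≠ 0) (ht : t ^ 2 ≠ 1) (n : ℤ) (hn : 0 < n) :
    cNum (t : ℂ) n ≠ 0 := by
  rw [cNum_ofReal]
  exact_mod_cast (qNum_pos ht0 ht hn).ne'

theorem pow_four_ne_one (ht : t ^ 2 ≠ 1) : (t : ℂ) ^ 4 ≠ 1 := by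
  intro h
  have h4 : t ^ 4 = 1 := by exact_mod_cast h
  have h5 : (t ^ 2 - 1) * (t ^ 2 + 1) = 0 := by linear_combination h4
  have h6 : t ^ 2 + 1 ≠ 0 := by positivity
  exact ht (sub_eq_zero.mp ((mul_eq_zero.mp h5).resolve_right h6))

theorem lam_ne_zero (ht0 : t ≠ 0) (ht : t ^ 2 ≠ 1) {l : ℕ} {m : ℤ} (h1 : -(l : ℤ) ≤ m)
    (h2 : m ≤ l) : lam t l m ≠ 0 := by
  obtain ⟨j, p, hm, hp⟩ := exists_nat_index h1 h2
  rw [lam_eq t hm hp]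
  exact smul_ne_zero (lam_coeff_ne_zero ht0 ht l j p)
    (descendant_ne_zero l (cNum_ne_zero ht0 ht) (by exact_mod_cast ht0) (pow_four_ne_one ht) j
      (by omega))

/-- These are eigenvectors of `ad k` with eigenvalues (t²)^m, distinct because t² is positive and
not 1. -/
theorem linearIndependent_lam (ht0 : t ≠ 0) (ht : t ^ 2 ≠ 1) (l : ℕ) :
    LinearIndependent ℂ (fun m : Set.Icc (-(l : ℤ)) l => lam t l m) := by
  refine Module.End.eigenvectors_linearIndependent' (ad ℂ (U t) (k t))
    (fun m : Set.Icc (-(l : ℤ)) l => (t : ℂ) ^ (2 * (m : ℤ))) ?_ _ fun m => ?_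
  · intro m n h
    have h' : t ^ (2 * (m : ℤ)) = t ^ (2 * (n : ℤ)) := by
      have h2 : (t : ℂ) ^ (2 * (m : ℤ)) = (t : ℂ) ^ (2 * (n : ℤ)) := h
      exact_mod_cast h2
    rw [zpow_mul, zpow_mul] at h'
    exact Subtype.ext (zpow_right_injective₀ (a := t ^ (2 : ℤ)) (by positivity)
      (by exact_mod_cast ht) h')
  · rw [Module.End.hasEigenvector_iff, Module.End.mem_eigenspace_iff]
    exact ⟨ad_k_lam ht0 m.2.1 m.2.2, lam_ne_zero ht0 ht m.2.1 m.2.2⟩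

theorem span_lam (ht0 : t ≠ 0) (ht : t ^ 2 ≠ 1) (l : ℕ) :
    Submodule.span ℂ (lam t l '' Set.Icc (-(l : ℤ)) l) = descSpan (t : ℂ) l (2 * l + 1) := by
  apply le_antisymm
  · rw [Submodule.span_le]
    rintro _ ⟨m, hm, rfl⟩
    obtain ⟨j, p, hj, hp⟩ := exists_nat_index hm.1 hm.2
    rw [lam_eq t hj hp]
    exact Submodule.smul_mem _ _ (descendant_mem l (by omega))
  · rw [descSpan, Submodule.span_le]
    rintro _ ⟨j, hj, rfl⟩
    rw [Set.mem_Iio] at hj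
    have h : lam t l (l - j) ∈ Submodule.span ℂ (lam t l '' Set.Icc (-(l : ℤ)) l) :=
      Submodule.subset_span ⟨_, ⟨by omega, by omega⟩, rfl⟩
    rw [lam_eq t rfl (show j + (2 * l - j) = 2 * l by omega)] at h
    exact (Submodule.smul_mem_iff _ (lam_coeff_ne_zero ht0 ht l j _)).mp h

end real

end QuantumSU2

end

/-! ### Assembly of the main theorem -/

theorem proposition3 (t : ℝ) (ht0 : t ≠ 0) (ht1 : t ≠ 1) (ht2 : t ≠ -1) (l : ℕ) :
    (∀ m : ℤ, -(l : ℤ) ≤ m → m ≤ l →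
      HopfAlgebra.ad ℂ (QuantumSU2.U t) (QuantumSU2.e t) (QuantumSU2.lam t l m) =
        ((Real.sqrt (QuantumSU2.qNum t (l - m) * QuantumSU2.qNum t (l + m + 1)) : ℝ) : ℂ) •
          QuantumSU2.lam t l (m + 1) ∧
      HopfAlgebra.ad ℂ (QuantumSU2.U t) (QuantumSU2.f t) (QuantumSU2.lam t l m) =
        ((Real.sqrt (QuantumSU2.qNum t (l + m) * QuantumSU2.qNum t (l - m + 1)) : ℝ) : ℂ) •
          QuantumSU2.lam t l (m - 1) ∧
      HopfAlgebra.ad ℂ (QuantumSU2.U t) (QuantumSU2.k t) (QuantumSU2.lam t l m) =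
        ((t : ℂ) ^ (2 * m)) • QuantumSU2.lam t l m ∧
      HopfAlgebra.ad ℂ (QuantumSU2.U t) (QuantumSU2.kinv t) (QuantumSU2.lam t l m) =
        ((t : ℂ) ^ (-2 * m)) • QuantumSU2.lam t l m) ∧
    LinearIndependent ℂ (fun m : Set.Icc (-(l : ℤ)) l => QuantumSU2.lam t l m) ∧
    ∃ W : Subrepresentation (HopfAlgebra.adRep ℂ (QuantumSU2.U t)),
      W.toSubmodule =
        Submodule.span ℂ (QuantumSU2.lam t l '' Set.Icc (-(l : ℤ)) l) ∧
      Module.finrank ℂ W.toSubmodule = 2 * l + 1 ∧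
      W.toRepresentation.IsIrreducible := by

  have ht := QuantumSU2.sq_ne_one_of_ne ht1 ht2
  have htc : (t : ℂ) ≠ 0 := by exact_mod_cast ht0
  have hspan := QuantumSU2.span_lam ht0 ht l
  have hli := QuantumSU2.linearIndependent_lam ht0 ht l
  refine ⟨fun m h1 h2 => ?_, hli, ⟨Submodule.span ℂ (QuantumSU2.lam t l '' Set.Icc (-(l : ℤ)) l),
    fun a x hx => ?_⟩, rfl, ?_, ?_⟩
  · obtain ⟨j, p, hm, hp⟩ := QuantumSU2.exists_nat_index h1 h2
    exact ⟨QuantumSU2.ad_e_lam ht0 ht hm hp, QuantumSU2.ad_f_lam ht0 ht hm hp,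
      QuantumSU2.ad_k_lam ht0 h1 h2, QuantumSU2.ad_kinv_lam ht0 h1 h2⟩
  · rw [hspan] at hx ⊢
    exact QuantumSU2.ad_mem_descSpan l htc a x hx
  · have h := finrank_span_eq_card hli
    rw [← Set.image_eq_range] at h
    refine h.trans ?_
    rw [← Set.toFinset_card, Set.toFinset_Icc, Int.card_Icc]
    omega
  · exact QuantumSU2.isIrreducible_of_descSpan l (QuantumSU2.cNum_ne_zero ht0 ht) htc
      (QuantumSU2.pow_four_ne_one ht) _ hspan
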